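/- For complex parameters $m,n$, consider the Painlevé-III equation $$u''=\frac{(u')^2}{u}-\frac{u'}{x}+\frac{4\Theta_0u^2+4(1-\Theta_\infty)}{x}+4u^3-\frac4u,\qquad \Theta_0=n+m,\quad \Theta_\infty=m-n+1,$$ for a function $u$ of $x$. For $m\in\mathbb{C}$ define rational functions $s_k(x;m)$, $k\ge -1$, by $s_{-1}(x;m)=s_0(x;m)=1$ and $$s_{k+1}=\frac{(4x+2m+1)s_k^2-s_ks_k'-x\left(s_ks_k''-(s_k')^2\right)}{2s_{k-1}},\qquad k\ge 0,$$ where $s_j=s_j(x;m)$ and $'=\mathrm{d}/\mathrm{d}x$. For integers $n\ge 0$ set $$u_n(x;m)=\frac{s_n(x;m-1)\,s_{n-1}(x;m)}{s_n(x;m)\,s_{n-1}(x;m-1)},\qquad u_{-n}(x;m)=\frac{1}{u_n(x;m)}.$$ Let $m\in\mathbb{C}\setminus\mathbb{Z}$ and $n\in\mathbb{Z}$. Then the Painlevé-III equation with parameters $(m,n)$ has exactly two solutions that are (nonzero) rational functions of $x$ with complex coefficients, namely $u_n(x;m)$ and $-u_n(-x;m)$, and these two are distinct. -/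

import Mathlib

open Polynomial

noncomputable section

namespace PainleveIII

/-- The derivative `d/dx` on the field `ℂ(x)`, given by the quotient rule applied to the
reduced fraction `u = p / q`. -/
def ratDeriv (u : RatFunc ℂ) : RatFunc ℂ :=
  algebraMap ℂ[X] (RatFunc ℂ)
      (derivative u.num * u.denom - u.num * derivative u.denom) /
    algebraMap ℂ[X] (RatFunc ℂ) (u.denom ^ 2)

/-- The value of `u ∈ ℂ(x)` at a complex number `z` (meaningful if `z` is not a pole). -/
def ratEval (u : RatFunc ℂ) (z : ℂ) : ℂ := RatFunc.eval (RingHom.id ℂ) z u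

/-- Away from the poles of `u`, `ratDeriv u` is the complex derivative of `u`. -/
theorem hasDerivAt_ratEval (u : RatFunc ℂ) (z : ℂ) (hz : u.denom.eval z ≠ 0) :
    HasDerivAt (ratEval u) (ratEval (ratDeriv u) z) z := by
  have hd : ∀ p : ℂ[X], RatFunc.eval (RingHom.id ℂ) z (algebraMap ℂ[X] (RatFunc ℂ) p)
      = p.eval z := by
    intro p
    simp [RatFunc.eval, RatFunc.num_algebraMap, RatFunc.denom_algebraMap]
  have hq : (derivative u.num * u.denom - u.num * derivative u.denom).eval z
      / (u.denom ^ 2).eval z = ratEval (ratDeriv u) z := by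
    set a := derivative u.num * u.denom - u.num * derivative u.denom
    have h2 : (u.denom ^ 2).eval z ≠ 0 := by simpa using hz
    have hne : (algebraMap ℂ[X] (RatFunc ℂ) (u.denom ^ 2)) ≠ 0 := by
      simpa using RatFunc.algebraMap_ne_zero (pow_ne_zero 2 u.denom_ne_zero)
    have hdvd : (ratDeriv u).denom ∣ u.denom ^ 2 := by
      exact RatFunc.denom_div_dvd a (u.denom ^ 2)
    have hden : (ratDeriv u).denom.eval z ≠ 0 := by
      obtain ⟨c, hc⟩ := hdvd
      intro h0
      apply h2
      rw [hc, eval_mul, h0, zero_mul]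
    have hmul : ratDeriv u * algebraMap ℂ[X] (RatFunc ℂ) (u.denom ^ 2)
        = algebraMap ℂ[X] (RatFunc ℂ) a := by
      unfold ratDeriv
      exact div_mul_cancel₀ _ hne
    have h3 := RatFunc.eval_mul (f := RingHom.id ℂ) (a := z) (x := ratDeriv u)
      (y := algebraMap ℂ[X] (RatFunc ℂ) (u.denom ^ 2))
      (by simpa [eval₂_id] using hden) (by rw [RatFunc.denom_algebraMap]; simp)
    rw [hmul, hd, hd] at h3
    rw [h3, mul_div_cancel_right₀ _ h2]
    rfl
  rw [← hq]
  have h := (u.num.hasDerivAt z).div (u.denom.hasDerivAt z) hz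
  have hf : ratEval u = fun y => u.num.eval y / u.denom.eval y := by
    funext y
    simp [ratEval, RatFunc.eval, eval₂_id]
  rw [hf]
  refine h.congr_deriv ?_
  simp only [eval_sub, eval_mul, eval_pow]

/-- `u ∈ ℂ(x)` is a (rational) solution of the Painlevé-III equation
`u'' = (u')² / u - u' / x + (4 Θ₀ u² + 4 (1 - Θ_∞)) / x + 4 u³ - 4 / u`
with `Θ₀ = n + m` and `Θ_∞ = m - n + 1`. -/
def IsRationalSolution (m n : ℂ) (u : RatFunc ℂ) : Prop :=
  u ≠ 0 ∧
    ratDeriv (ratDeriv u) =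
      (ratDeriv u) ^ 2 / u - ratDeriv u / RatFunc.X
        + (4 * RatFunc.C (n + m) * u ^ 2 + 4 * (1 - RatFunc.C (m - n + 1))) / RatFunc.X
        + 4 * u ^ 3 - 4 / u

/-- The Umemura sequence with its index shifted by one: `umemura m k` is `s_{k-1}(x; m)`, where
`s_{-1} = s_0 = 1` and, for `n ≥ 0`,
`s_{n+1} = ((4 x + 2 m + 1) s_n² - s_n s_n' - x (s_n s_n'' - (s_n')²)) / (2 s_{n-1})`. -/
def umemura (m : ℂ) : ℕ → RatFunc ℂ
  | 0 => 1
  | 1 => 1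
  | k + 2 =>
    ((4 * RatFunc.X + RatFunc.C (2 * m + 1)) * umemura m (k + 1) ^ 2
        - umemura m (k + 1) * ratDeriv (umemura m (k + 1))
        - RatFunc.X * (umemura m (k + 1) * ratDeriv (ratDeriv (umemura m (k + 1)))
            - ratDeriv (umemura m (k + 1)) ^ 2))
      / (2 * umemura m k)

/-- `u_n(x; m) = s_n(x; m-1) s_{n-1}(x; m) / (s_n(x; m) s_{n-1}(x; m-1))` for natural `n`. -/
def uNat (m : ℂ) (n : ℕ) : RatFunc ℂ :=
  (umemura (m - 1) (n + 1) * umemura m n) / (umemura m (n + 1) * umemura (m - 1) n)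

/-- `u_n(x; m)` for all integers `n`, with `u_{-n}(x; m) = 1 / u_n(x; m)` for `n ≥ 0`. -/
def uInt (m : ℂ) (n : ℤ) : RatFunc ℂ :=
  if 0 ≤ n then uNat m n.toNat else (uNat m (-n).toNat)⁻¹

/-- The odd reflection `u(x) ↦ -u(-x)` on `ℂ(x)`. -/
def oddReflection (u : RatFunc ℂ) : RatFunc ℂ :=
  -RatFunc.eval (RatFunc.C : ℂ →+* RatFunc ℂ) (-RatFunc.X) u

end PainleveIII

end

open Polynomial

noncomputable section

namespace PainleveIII

/-! ### The derivation of `ℂ(x)` -/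

local notation "ι" => algebraMap ℂ[X] (RatFunc ℂ)

theorem ratDeriv_eq_of_eq_div {u : RatFunc ℂ} {p q : ℂ[X]} (hq : q ≠ 0) (hu : u = ι p / ι q) :
    ratDeriv u = ι (derivative p * q - p * derivative q) / ι (q ^ 2) := by
  have h : u.num * q = p * u.denom := (RatFunc.num_mul_eq_mul_denom_iff hq).mpr hu
  have h' := congrArg derivative h
  simp only [derivative_mul] at h'
  have hd := u.denom_ne_zero
  rw [ratDeriv, div_eq_div_iff (RatFunc.algebraMap_ne_zero (pow_ne_zero 2 hd))
    (RatFunc.algebraMap_ne_zero (pow_ne_zero 2 hq)), ← map_mul, ← map_mul]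
  refine congrArg _ ?_
  linear_combination u.denom * q * h' - (derivative u.denom * q + u.denom * derivative q) * h

theorem ratDeriv_mk (p q : ℂ[X]) (hq : q ≠ 0) :
    ratDeriv (ι p / ι q) = ι (derivative p * q - p * derivative q) / ι (q ^ 2) :=
  ratDeriv_eq_of_eq_div hq rfl

theorem exists_eq_div (u : RatFunc ℂ) : ∃ p q : ℂ[X], q ≠ 0 ∧ u = ι p / ι q :=
  ⟨u.num, u.denom, u.denom_ne_zero, (RatFunc.num_div_denom u).symm⟩

theorem ratDeriv_algebraMap (p : ℂ[X]) : ratDeriv (ι p) = ι (derivative p) := by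
  have := ratDeriv_mk p 1 one_ne_zero
  simpa using this

theorem ratDeriv_mul (u v : RatFunc ℂ) :
    ratDeriv (u * v) = u * ratDeriv v + v * ratDeriv u := by
  obtain ⟨p, q, hq, rfl⟩ := exists_eq_div u
  obtain ⟨r, s, hs, rfl⟩ := exists_eq_div v
  rw [div_mul_div_comm, ← map_mul, ← map_mul, ratDeriv_mk _ _ (mul_ne_zero hq hs),
    ratDeriv_mk _ _ hq, ratDeriv_mk _ _ hs]
  have h1 : ι q ≠ 0 := RatFunc.algebraMap_ne_zero hq
  have h2 : ι s ≠ 0 := RatFunc.algebraMap_ne_zero hs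
  simp only [derivative_mul, map_mul, map_sub, map_add, map_pow]
  field_simp
  ring

theorem ratDeriv_add (u v : RatFunc ℂ) : ratDeriv (u + v) = ratDeriv u + ratDeriv v := by
  obtain ⟨p, q, hq, rfl⟩ := exists_eq_div u
  obtain ⟨r, s, hs, rfl⟩ := exists_eq_div v
  have h1 : ι q ≠ 0 := RatFunc.algebraMap_ne_zero hq
  have h2 : ι s ≠ 0 := RatFunc.algebraMap_ne_zero hs
  rw [div_add_div _ _ h1 h2, ← map_mul, ← map_mul, ← map_mul, ← map_add,
    ratDeriv_mk _ _ (mul_ne_zero hq hs), ratDeriv_mk _ _ hq, ratDeriv_mk _ _ hs]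
  simp only [derivative_mul, map_mul, map_sub, map_add, map_pow]
  field_simp
  ring

theorem ratDeriv_C (c : ℂ) : ratDeriv (RatFunc.C c) = 0 := by
  have := ratDeriv_algebraMap (C c)
  simpa using this

theorem ratDeriv_X : ratDeriv RatFunc.X = 1 := by
  have := ratDeriv_algebraMap X
  simpa using this

/-- `ratDeriv` as a derivation of `ℂ(x)` over `ℂ`. -/
def ratDer : Derivation ℂ (RatFunc ℂ) (RatFunc ℂ) where
  toFun := ratDeriv
  map_add' := ratDeriv_add
  map_smul' c u := by
    rw [RatFunc.smul_eq_C_mul, ratDeriv_mul, ratDeriv_C, mul_zero, add_zero, RingHom.id_apply,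
      RatFunc.smul_eq_C_mul]
  map_one_eq_zero' := by
    have := ratDeriv_C 1
    simpa using this
  leibniz' u v := by simpa using ratDeriv_mul u v

theorem ratDeriv_eq (u : RatFunc ℂ) : ratDeriv u = ratDer u := rfl

@[simp] theorem ratDer_C (c : ℂ) : ratDer (RatFunc.C c) = 0 := ratDeriv_C c

@[simp] theorem ratDer_X : ratDer RatFunc.X = 1 := ratDeriv_X

@[simp] theorem ratDer_ofNat (k : ℕ) [k.AtLeastTwo] :
    ratDer (OfNat.ofNat k : RatFunc ℂ) = 0 := by
  rw [← map_ofNat RatFunc.C k, ratDer_C]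

theorem ratDer_div (u v : RatFunc ℂ) :
    ratDer (u / v) = (v * ratDer u - u * ratDer v) / v ^ 2 := by
  rw [Derivation.leibniz_div]
  simp only [smul_eq_mul, inv_pow]
  rw [inv_mul_eq_div]

theorem ratDer_inv (u : RatFunc ℂ) : ratDer u⁻¹ = -ratDer u / u ^ 2 := by
  rw [Derivation.leibniz_inv, smul_eq_mul, inv_pow]
  ring

/-! ### The filtration by the degree at infinity -/

/-- Rational functions that are `O(x ^ d)` at infinity. -/
def degLE (d : ℤ) : AddSubgroup (RatFunc ℂ) where
  carrier := {u | u = 0 ∨ u.intDegree ≤ d}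
  zero_mem' := Or.inl rfl
  neg_mem' := by
    intro u hu
    simpa using hu
  add_mem' := by
    intro u v hu hv
    by_cases h : u + v = 0
    · exact Or.inl h
    rcases hu with rfl | hu
    · simpa using hv
    rcases hv with rfl | hv
    · exact Or.inr (by simpa using hu)
    by_cases hv0 : v = 0
    · subst hv0
      exact Or.inr (by simpa using hu)
    exact Or.inr ((RatFunc.intDegree_add_le hv0 h).trans (max_le hu hv))

theorem mem_degLE {d : ℤ} {u : RatFunc ℂ} : u ∈ degLE d ↔ u = 0 ∨ u.intDegree ≤ d := Iff.rfl

theorem intDegree_le_of_mem {d : ℤ} {u : RatFunc ℂ} (hu : u ≠ 0) (h : u ∈ degLE d) :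
    u.intDegree ≤ d := h.resolve_left hu

theorem mem_degLE_intDegree (u : RatFunc ℂ) : u ∈ degLE u.intDegree := Or.inr le_rfl

theorem degLE_mono {d e : ℤ} (h : d ≤ e) {u : RatFunc ℂ} (hu : u ∈ degLE d) : u ∈ degLE e :=
  hu.imp_right fun h' => h'.trans h

theorem mul_mem_degLE {d e : ℤ} {u v : RatFunc ℂ} (hu : u ∈ degLE d) (hv : v ∈ degLE e) :
    u * v ∈ degLE (d + e) := by
  by_cases hu0 : u = 0
  · simp [hu0]
  by_cases hv0 : v = 0
  · simp [hv0]
  exact Or.inr ((RatFunc.intDegree_mul hu0 hv0).le.trans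
    (add_le_add (intDegree_le_of_mem hu0 hu) (intDegree_le_of_mem hv0 hv)))

theorem pow_mem_degLE {d : ℤ} {u : RatFunc ℂ} (hu : u ∈ degLE d) (k : ℕ) :
    u ^ k ∈ degLE (k * d) := by
  induction k with
  | zero => exact Or.inr (by simp)
  | succ k ih =>
    rw [pow_succ]
    convert! mul_mem_degLE ih hu using 2
    push_cast
    ring

theorem C_mem_degLE (c : ℂ) : RatFunc.C c ∈ degLE 0 := Or.inr (by simp)

theorem ofNat_mem_degLE (k : ℕ) [k.AtLeastTwo] : (OfNat.ofNat k : RatFunc ℂ) ∈ degLE 0 := by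
  rw [← map_ofNat RatFunc.C k]
  exact C_mem_degLE _

theorem X_mem_degLE : (RatFunc.X : RatFunc ℂ) ∈ degLE 1 := Or.inr (by simp)

theorem ratDer_mem_degLE {d : ℤ} {u : RatFunc ℂ} (hu : u ∈ degLE d) : ratDer u ∈ degLE (d - 1) := by
  by_cases hu0 : u = 0
  · simp [hu0]
  suffices h : ratDer u ∈ degLE (u.intDegree - 1) from
    degLE_mono (by linarith [intDegree_le_of_mem hu0 hu]) h
  by_cases h0 : ratDer u = 0
  · exact Or.inl h0
  refine Or.inr ?_
  have hq := u.denom_ne_zero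
  have hdef : ratDer u = ι (derivative u.num * u.denom - u.num * derivative u.denom) /
    ι (u.denom ^ 2) := rfl
  have hne : derivative u.num * u.denom - u.num * derivative u.denom ≠ 0 := by
    intro h
    apply h0
    rw [hdef, h, map_zero, zero_div]
  rw [hdef, RatFunc.intDegree_div (RatFunc.algebraMap_ne_zero hne)
    (RatFunc.algebraMap_ne_zero (pow_ne_zero 2 hq)), RatFunc.intDegree_polynomial,
    RatFunc.intDegree_polynomial, natDegree_pow, RatFunc.intDegree]
  have hle : (derivative u.num * u.denom - u.num * derivative u.denom).natDegree + 1 ≤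
      u.num.natDegree + u.denom.natDegree := by
    have hdeg : (derivative u.num * u.denom - u.num * derivative u.denom).degree <
        ((u.num.natDegree + u.denom.natDegree : ℕ) : WithBot ℕ) := by
      have hp := RatFunc.num_ne_zero hu0
      refine (degree_sub_le _ _).trans_lt (max_lt ?_ ?_)
      · rw [Nat.cast_add, ← degree_eq_natDegree hp, ← degree_eq_natDegree hq, degree_mul]
        exact WithBot.add_lt_add_right (by simpa using hq) (degree_derivative_lt hp)
      · rw [Nat.cast_add, ← degree_eq_natDegree hp, ← degree_eq_natDegree hq, degree_mul]
        exact WithBot.add_lt_add_left (by simpa using hp) (degree_derivative_lt hq)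
    rw [degree_eq_natDegree hne] at hdeg
    exact_mod_cast hdeg
  push_cast
  omega

theorem C_mem_degLE_neg {c : ℂ} (h : RatFunc.C c ∈ degLE (-1)) : c = 0 := by
  by_contra hc
  have := intDegree_le_of_mem (by simpa using hc) h
  simp at this

theorem intDegree_eq_zero_of_sub_C_mem {c : ℂ} (hc : c ≠ 0) {u : RatFunc ℂ}
    (hu : u - RatFunc.C c ∈ degLE (-1)) : u ≠ 0 ∧ u.intDegree = 0 := by
  have h0 : u ∉ degLE (-1) := fun h =>
    hc (C_mem_degLE_neg (by simpa using (degLE (-1)).sub_mem h hu))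
  have h1 : u ∈ degLE 0 := by
    simpa using (degLE 0).add_mem (degLE_mono (by norm_num) hu) (C_mem_degLE c)
  rw [mem_degLE, not_or] at h0
  exact ⟨h0.1, le_antisymm (intDegree_le_of_mem h0.1 h1) (by omega)⟩

theorem inv_mem_degLE {u : RatFunc ℂ} : u⁻¹ ∈ degLE (-u.intDegree) := Or.inr (by simp)

/-! ### The reflection -/

theorem nonZeroDivisors_le_comap_comp_neg :
    nonZeroDivisors ℂ[X] ≤ (nonZeroDivisors ℂ[X]).comap (compRingHom (-X : ℂ[X])) := by
  intro p hp
  rw [Submonoid.mem_comap, mem_nonZeroDivisors_iff_ne_zero]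
  intro h
  rw [mem_nonZeroDivisors_iff_ne_zero] at hp
  apply hp
  have := congrArg (fun q : ℂ[X] => q.comp (-X)) h
  simpa [comp_assoc] using this

/-- The automorphism `u(x) ↦ u(-x)` of `ℂ(x)`. -/
def refl : RatFunc ℂ →+* RatFunc ℂ :=
  RatFunc.mapRingHom (compRingHom (-X : ℂ[X])) nonZeroDivisors_le_comap_comp_neg

theorem refl_div (p q : ℂ[X]) :
    refl (ι p / ι q) = ι (p.comp (-X)) / ι (q.comp (-X)) := by
  rw [refl, RatFunc.coe_mapRingHom_eq_coe_map, RatFunc.map_apply_div]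
  rfl

@[simp] theorem refl_algebraMap (p : ℂ[X]) : refl (ι p) = ι (p.comp (-X)) := by
  simpa using refl_div p 1

@[simp] theorem refl_X : refl RatFunc.X = -RatFunc.X := by
  simpa using refl_algebraMap X

@[simp] theorem refl_C (c : ℂ) : refl (RatFunc.C c) = RatFunc.C c := by
  simpa using refl_algebraMap (C c)

theorem oddReflection_eq (u : RatFunc ℂ) : oddReflection u = -refl u := by
  have h : ∀ p : ℂ[X], p.eval₂ (RatFunc.C : ℂ →+* RatFunc ℂ) (-RatFunc.X) = ι (p.comp (-X)) := by
    intro p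
    rw [comp, hom_eval₂]
    congr 1
    simp
  conv_rhs => rw [← RatFunc.num_div_denom u, refl_div]
  rw [oddReflection, RatFunc.eval, h, h]

theorem ratDer_refl (u : RatFunc ℂ) : ratDer (refl u) = -refl (ratDer u) := by
  obtain ⟨p, q, hq, rfl⟩ := exists_eq_div u
  have hp : ∀ p : ℂ[X], ratDer (refl (ι p)) = -refl (ratDer (ι p)) := by
    intro p
    rw [refl_algebraMap, ← ratDeriv_eq, ← ratDeriv_eq, ratDeriv_algebraMap, ratDeriv_algebraMap,
      refl_algebraMap, derivative_comp]
    simp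
  rw [map_div₀, ratDer_div, ratDer_div, hp, hp, map_div₀, map_sub, map_mul, map_mul, map_pow]
  ring

theorem refl_mem_degLE {d : ℤ} {u : RatFunc ℂ} (hu : u ∈ degLE d) : refl u ∈ degLE d := by
  by_cases hu0 : u = 0
  · simp [hu0]
  refine Or.inr (le_trans (le_of_eq ?_) (intDegree_le_of_mem hu0 hu))
  have h : ∀ p : ℂ[X], p ≠ 0 → ι (p.comp (-X)) ≠ 0 := fun p hp h0 =>
    (map_ne_zero refl).mpr (RatFunc.algebraMap_ne_zero hp) (by simpa using h0)
  conv_lhs => rw [← RatFunc.num_div_denom u, refl_div]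
  rw [RatFunc.intDegree_div (h _ (RatFunc.num_ne_zero hu0)) (h _ u.denom_ne_zero),
    RatFunc.intDegree_polynomial, RatFunc.intDegree_polynomial, natDegree_comp, natDegree_comp,
    RatFunc.intDegree]
  simp

local notation "x" => (RatFunc.X : RatFunc ℂ)

theorem ratDer_two : ratDer 2 = 0 := ratDer_ofNat 2

/-! ### Euler's logarithmic derivative -/

/-- The logarithmic derivative `x u' / u`. -/
def eulerLog (u : RatFunc ℂ) : RatFunc ℂ := x * ratDer u / u

theorem eulerLog_mul {u v : RatFunc ℂ} (hu : u ≠ 0) (hv : v ≠ 0) :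
    eulerLog (u * v) = eulerLog u + eulerLog v := by
  simp only [eulerLog, Derivation.leibniz, smul_eq_mul]
  field_simp
  ring

theorem eulerLog_div {u v : RatFunc ℂ} (hu : u ≠ 0) (hv : v ≠ 0) :
    eulerLog (u / v) = eulerLog u - eulerLog v := by
  have h := eulerLog_mul (div_ne_zero hu hv) hv
  rw [div_mul_cancel₀ _ hv] at h
  rw [h, add_sub_cancel_right]

theorem eulerLog_inv (u : RatFunc ℂ) : eulerLog u⁻¹ = -eulerLog u := by
  rcases eq_or_ne u 0 with rfl | hu
  · simp [eulerLog]
  · rw [← one_div, eulerLog_div one_ne_zero hu]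
    simp [eulerLog]

theorem eulerLog_ofNat (k : ℕ) [k.AtLeastTwo] :
    eulerLog (OfNat.ofNat k : RatFunc ℂ) = 0 := by
  simp [eulerLog]

theorem eulerLog_sq {u : RatFunc ℂ} (hu : u ≠ 0) : eulerLog (u ^ 2) = 2 * eulerLog u := by
  rw [sq, eulerLog_mul hu hu]
  ring

theorem eulerLog_mem_degLE (u : RatFunc ℂ) : eulerLog u ∈ degLE 0 := by
  rw [eulerLog, div_eq_mul_inv]
  refine degLE_mono (le_of_eq ?_)
    (mul_mem_degLE (mul_mem_degLE X_mem_degLE (ratDer_mem_degLE (mem_degLE_intDegree u)))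
      inv_mem_degLE)
  ring

/-! ### The equation as a first-order system -/

theorem isRationalSolution_iff_eulerLog (m n : ℂ) (u : RatFunc ℂ) :
    IsRationalSolution m n u ↔ u ≠ 0 ∧ ratDer (eulerLog u) =
      4 * RatFunc.C (n + m) * u + 4 * RatFunc.C (n - m) / u + 4 * x * u ^ 2 - 4 * x / u ^ 2 := by
  unfold IsRationalSolution
  refine and_congr_right fun hu => ?_
  have hx : x ≠ 0 := RatFunc.X_ne_zero
  have h1 : (1 : RatFunc ℂ) - RatFunc.C (m - n + 1) = RatFunc.C (n - m) := by
    simp only [map_sub, map_add, map_one]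
    ring
  rw [h1, ratDeriv_eq, ratDeriv_eq, eulerLog, ratDer_div]
  simp only [Derivation.leibniz, smul_eq_mul, ratDer_X]
  generalize ratDer (ratDer u) = u2
  generalize ratDer u = u1
  generalize RatFunc.C (n - m) = a
  generalize RatFunc.C (n + m) = b
  constructor
  · rintro rfl
    field_simp
    ring
  · intro h
    have h2 : x * u2 / u = u1 ^ 2 * x / u ^ 2 - u1 / u + (4 * b * u + 4 * a / u + 4 * x * u ^ 2
        - 4 * x / u ^ 2) := by
      rw [← h]
      field_simp
      ring
    have h3 : u2 = (x * u2 / u) * (u / x) := by field_simp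
    rw [h3, h2]
    field_simp
    ring

/-- The variable conjugate to `u` in the direction of increasing `n`. -/
def upper (u : RatFunc ℂ) : RatFunc ℂ := eulerLog u + 2 * x * (u + 1 / u)

/-- The variable conjugate to `u` in the direction of decreasing `n`. -/
def lower (u : RatFunc ℂ) : RatFunc ℂ := -eulerLog u + 2 * x * (u + 1 / u)

theorem eulerLog_eq_of_upper (u : RatFunc ℂ) :
    eulerLog u = upper u - 2 * x * (u + 1 / u) := by
  rw [upper]
  ring

theorem lower_eq (u : RatFunc ℂ) : lower u = 4 * x * (u + 1 / u) - upper u := by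
  rw [upper, lower]
  ring

theorem X_mul_ratDer {u : RatFunc ℂ} (hu : u ≠ 0) : x * ratDer u = u * eulerLog u := by
  rw [eulerLog]
  field_simp

theorem ratDer_X_mul_add_inv {u : RatFunc ℂ} (hu : u ≠ 0) :
    ratDer (2 * x * (u + 1 / u)) = 2 * (u + 1 / u) + 2 * eulerLog u * (u - 1 / u) := by
  rw [eulerLog]
  simp only [Derivation.leibniz, smul_eq_mul, map_add, one_div, ratDer_inv, ratDer_X, ratDer_two]
  field_simp
  ring

theorem isRationalSolution_iff_upper (m n : ℂ) (u : RatFunc ℂ) :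
    IsRationalSolution m n u ↔ u ≠ 0 ∧ ratDer (upper u) =
      2 * u * (upper u + RatFunc.C (2 * n + 2 * m + 1))
        - 2 * (upper u + RatFunc.C (-2 * n + 2 * m - 1)) / u := by
  rw [isRationalSolution_iff_eulerLog]
  refine and_congr_right fun hu => ?_
  have h : ratDer (upper u) = ratDer (eulerLog u) +
      (2 * (u + 1 / u) + 2 * eulerLog u * (u - 1 / u)) := by
    rw [upper, map_add, ratDer_X_mul_add_inv hu]
  rw [h, upper, ← eq_sub_iff_add_eq]
  refine Eq.congr_right ?_
  generalize eulerLog u = y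
  simp only [map_add, map_sub, map_mul, map_neg, map_one, map_ofNat]
  field_simp
  ring

theorem isRationalSolution_iff_lower (m n : ℂ) (u : RatFunc ℂ) :
    IsRationalSolution m n u ↔ u ≠ 0 ∧ ratDer (lower u) =
      -2 * u * (lower u + RatFunc.C (2 * n + 2 * m - 1))
        + 2 * (lower u + RatFunc.C (-2 * n + 2 * m + 1)) / u := by
  rw [isRationalSolution_iff_eulerLog]
  refine and_congr_right fun hu => ?_
  have h : ratDer (lower u) = -ratDer (eulerLog u) +
      (2 * (u + 1 / u) + 2 * eulerLog u * (u - 1 / u)) := by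
    rw [lower, map_add, map_neg, ratDer_X_mul_add_inv hu]
  rw [h, lower, ← eq_sub_iff_add_eq, neg_eq_iff_eq_neg]
  refine Eq.congr_right ?_
  generalize eulerLog u = y
  simp only [map_add, map_sub, map_mul, map_neg, map_one, map_ofNat]
  field_simp
  ring

/-! ### The Bäcklund transformation -/

section Backlund

variable {m n : ℂ} {u v D N : RatFunc ℂ}

theorem lower_backlund (hu : u ≠ 0) (hD0 : D ≠ 0) (hN0 : N ≠ 0)
    (hD : D = upper u + RatFunc.C (2 * n + 2 * m + 1))
    (hN : N = upper u + RatFunc.C (-2 * n + 2 * m - 1))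
    (hW : ratDer (upper u) = 2 * u * D - 2 * N / u) (hv : v = N / (u * D)) :
    lower v = upper u := by
  have hDN : D - N = RatFunc.C (4 * n + 2) := by
    rw [hD, hN, add_sub_add_left_eq_sub, ← map_sub]
    congr 1
    ring
  have h1 : ratDer D = 2 * u * D - 2 * N / u := by rw [hD, map_add, ratDer_C, add_zero, ← hD, hW]
  have h2 : ratDer N = 2 * u * D - 2 * N / u := by rw [hN, map_add, ratDer_C, add_zero, ← hN, hW]
  have h3 : eulerLog v = eulerLog N - (eulerLog u + eulerLog D) := by
    rw [hv, eulerLog_div hN0 (mul_ne_zero hu hD0), eulerLog_mul hu hD0]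
  rw [lower, h3, eulerLog_eq_of_upper u, eulerLog, eulerLog, h1, h2, hv]
  field_simp
  ring

theorem isRationalSolution_backlund (hu : IsRationalSolution m n u) (hD0 : D ≠ 0) (hN0 : N ≠ 0)
    (hD : D = upper u + RatFunc.C (2 * n + 2 * m + 1))
    (hN : N = upper u + RatFunc.C (-2 * n + 2 * m - 1)) (hv : v = N / (u * D)) :
    IsRationalSolution m (n + 1) v := by
  obtain ⟨hu0, hW⟩ := (isRationalSolution_iff_upper m n u).mp hu
  rw [← hD, ← hN] at hW
  have hl := lower_backlund hu0 hD0 hN0 hD hN hW hv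
  refine (isRationalSolution_iff_lower m (n + 1) v).mpr
    ⟨hv ▸ div_ne_zero hN0 (mul_ne_zero hu0 hD0), ?_⟩
  have e1 : (2 * (n + 1) + 2 * m - 1 : ℂ) = 2 * n + 2 * m + 1 := by ring
  have e2 : (-2 * (n + 1) + 2 * m + 1 : ℂ) = -2 * n + 2 * m - 1 := by ring
  rw [hl, e1, e2, ← hD, ← hN, hW, hv]
  field_simp
  ring

theorem toda_backlund (hu : u ≠ 0) (hD0 : D ≠ 0) (hN0 : N ≠ 0)
    (hD : D = upper u + RatFunc.C (2 * n + 2 * m + 1))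
    (hN : N = upper u + RatFunc.C (-2 * n + 2 * m - 1))
    (hW : ratDer (upper u) = 2 * u * D - 2 * N / u) (hv : v = N / (u * D)) :
    2 * (u * D) - (lower u + RatFunc.C (-2 * n + 2 * m + 1)) / u - ratDer (eulerLog (u * D)) =
      v * (upper v + RatFunc.C (2 * (n + 1) + 2 * m + 1)) := by
  have hl := lower_backlund hu hD0 hN0 hD hN hW hv
  have hv0 : v ≠ 0 := hv ▸ div_ne_zero hN0 (mul_ne_zero hu hD0)
  have h1 : ratDer D = 2 * u * D - 2 * N / u := by rw [hD, map_add, ratDer_C, add_zero, ← hD, hW]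
  have hvD : N = v * u * D := by
    rw [hv]
    field_simp
  have hA : eulerLog (u * D) = upper u - 2 * x / u - 2 * x * v := by
    rw [eulerLog_mul hu hD0, eulerLog_eq_of_upper, eulerLog, h1, hvD]
    field_simp
    ring
  have hxu : x * ratDer u = u * (upper u - 2 * x * (u + 1 / u)) := by
    rw [X_mul_ratDer hu, eulerLog_eq_of_upper]
  have hxv : x * ratDer v = v * (2 * x * (v + 1 / v) - upper u) := by
    rw [X_mul_ratDer hv0, ← hl, lower]
    ring
  have hA' : ratDer (eulerLog (u * D)) = 2 * u * D - 2 * N / u - 2 / u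
      + 2 * (x * ratDer u) / u ^ 2 - 2 * v - 2 * (x * ratDer v) := by
    rw [hA, map_sub, map_sub, hW, ratDer_div]
    simp only [Derivation.leibniz, smul_eq_mul, ratDer_X, ratDer_two]
    field_simp
    ring
  have huv : upper v = 4 * x * (v + 1 / v) - upper u := by
    rw [← hl, lower_eq]
    ring
  have hW' : upper u = D - RatFunc.C (2 * n + 2 * m + 1) := by
    rw [hD]
    ring
  have hDN : v * u * D = D - RatFunc.C (4 * n + 2) := by
    rw [← hvD, hN, hD, add_sub_assoc (upper u), ← map_sub]
    congr 2
    ring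
  rw [hA', hxu, hxv, huv, lower_eq, hW', hvD]
  simp only [map_add, map_mul, map_neg, map_one, map_ofNat] at hDN ⊢
  field_simp
  linear_combination u * hDN

end Backlund

/-! ### The Toda equation for the Umemura sequence -/

/-- The Toda potential `4 x + 2 m + 1 - (x s' / s)'` of the `j`-th entry of the sequence. -/
def toda (m : ℂ) (j : ℕ) : RatFunc ℂ :=
  4 * x + RatFunc.C (2 * m + 1) - ratDer (eulerLog (umemura m j))

theorem toda_zero (m : ℂ) : toda m 0 = 4 * x + RatFunc.C (2 * m + 1) := by
  simp [toda, umemura, eulerLog]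

theorem toda_one (m : ℂ) : toda m 1 = 4 * x + RatFunc.C (2 * m + 1) := by
  simp [toda, umemura, eulerLog]

theorem toda_sub_mem_degLE (m : ℂ) (j : ℕ) : toda m j - 4 * x ∈ degLE 0 := by
  have h : toda m j - 4 * x = RatFunc.C (2 * m + 1) - ratDer (eulerLog (umemura m j)) := by
    rw [toda]
    ring
  rw [h]
  exact (degLE 0).sub_mem (C_mem_degLE _)
    (degLE_mono (by norm_num) (ratDer_mem_degLE (eulerLog_mem_degLE _)))

theorem intDegree_four_mul_X : (4 * x : RatFunc ℂ) ≠ 0 ∧ (4 * x).intDegree = 1 := by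
  have h4 : (4 : RatFunc ℂ) = RatFunc.C 4 := (map_ofNat RatFunc.C 4).symm
  have h4' : (4 : RatFunc ℂ) ≠ 0 := by norm_num
  refine ⟨mul_ne_zero h4' RatFunc.X_ne_zero, ?_⟩
  rw [RatFunc.intDegree_mul h4' RatFunc.X_ne_zero, h4, RatFunc.intDegree_C, RatFunc.intDegree_X,
    zero_add]

theorem toda_ne_zero_and_intDegree (m : ℂ) (j : ℕ) : toda m j ≠ 0 ∧ (toda m j).intDegree = 1 := by
  have h4 : (4 * x) ∉ degLE 0 := fun h => by
    have := intDegree_le_of_mem intDegree_four_mul_X.1 h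
    rw [intDegree_four_mul_X.2] at this
    norm_num at this
  have h0 : toda m j ∉ degLE 0 := fun h =>
    h4 (by simpa using (degLE 0).sub_mem h (toda_sub_mem_degLE m j))
  have h1 : toda m j ∈ degLE 1 := by
    have := (degLE 1).add_mem (degLE_mono zero_le_one (toda_sub_mem_degLE m j))
      (Or.inr intDegree_four_mul_X.2.le : 4 * x ∈ degLE 1)
    simpa using this
  rw [mem_degLE, not_or] at h0
  exact ⟨h0.1, le_antisymm (intDegree_le_of_mem h0.1 h1) (by omega)⟩

theorem umemura_succ_succ {m : ℂ} {k : ℕ} (h : umemura m (k + 1) ≠ 0) :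
    umemura m (k + 2) = umemura m (k + 1) ^ 2 * toda m (k + 1) / (2 * umemura m k) := by
  rw [umemura, toda, eulerLog, ratDer_div]
  simp only [ratDeriv_eq, Derivation.leibniz, smul_eq_mul, ratDer_X]
  congr 1
  field_simp
  ring

theorem umemura_ne_zero (m : ℂ) (j : ℕ) : umemura m j ≠ 0 := by
  induction j using Nat.strong_induction_on with
  | _ j ih =>
    match j with
    | 0 => exact one_ne_zero
    | 1 => exact one_ne_zero
    | k + 2 =>
      have h1 := ih (k + 1) (by omega)
      rw [umemura_succ_succ h1]
      exact div_ne_zero (mul_ne_zero (pow_ne_zero 2 h1) (toda_ne_zero_and_intDegree m _).1)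
        (mul_ne_zero two_ne_zero (ih k (by omega)))

theorem toda_succ_succ (m : ℂ) (j : ℕ) :
    toda m (j + 2) = 2 * toda m (j + 1) - toda m j - ratDer (eulerLog (toda m (j + 1))) := by
  have h0 := umemura_ne_zero m j
  have h1 := umemura_ne_zero m (j + 1)
  have ht := (toda_ne_zero_and_intDegree m (j + 1)).1
  have h : eulerLog (umemura m (j + 2)) = 2 * eulerLog (umemura m (j + 1)) +
      eulerLog (toda m (j + 1)) - eulerLog (umemura m j) := by
    rw [umemura_succ_succ h1,
      eulerLog_div (mul_ne_zero (pow_ne_zero 2 h1) ht) (mul_ne_zero two_ne_zero h0),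
      eulerLog_mul (pow_ne_zero 2 h1) ht, eulerLog_sq h1, eulerLog_mul two_ne_zero h0,
      eulerLog_ofNat, zero_add]
  have h' := congrArg ratDer h
  simp only [map_add, map_sub, Derivation.leibniz, smul_eq_mul, ratDer_two, mul_zero, add_zero] at h'
  have e : ∀ j, ratDer (eulerLog (umemura m j)) =
      4 * x + RatFunc.C (2 * m + 1) - toda m j := fun j => by
    rw [toda]
    ring
  rw [toda, h', e, e]
  ring

theorem uNat_ne_zero (m : ℂ) (n : ℕ) : uNat m n ≠ 0 :=
  div_ne_zero (mul_ne_zero (umemura_ne_zero _ _) (umemura_ne_zero _ _))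
    (mul_ne_zero (umemura_ne_zero _ _) (umemura_ne_zero _ _))

theorem uNat_zero (m : ℂ) : uNat m 0 = 1 := by
  simp [uNat, umemura]

theorem uNat_succ (m : ℂ) (n : ℕ) :
    uNat m (n + 1) = uNat m n * toda (m - 1) (n + 1) / toda m (n + 1) := by
  have h0 := umemura_ne_zero m n
  have h1 := umemura_ne_zero m (n + 1)
  have h2 := umemura_ne_zero (m - 1) n
  have h3 := umemura_ne_zero (m - 1) (n + 1)
  have h4 := (toda_ne_zero_and_intDegree m (n + 1)).1
  have h5 := (toda_ne_zero_and_intDegree (m - 1) (n + 1)).1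
  rw [uNat, uNat, umemura_succ_succ h1, umemura_succ_succ h3]
  field_simp

theorem toda_pred (m : ℂ) (n : ℕ) :
    toda (m - 1) (n + 1) =
      toda m (n + 1) - toda m n + toda (m - 1) n - ratDer (eulerLog (uNat m n)) := by
  have h0 := umemura_ne_zero m n
  have h1 := umemura_ne_zero m (n + 1)
  have h2 := umemura_ne_zero (m - 1) n
  have h3 := umemura_ne_zero (m - 1) (n + 1)
  rw [uNat, eulerLog_div (mul_ne_zero h3 h0) (mul_ne_zero h1 h2), eulerLog_mul h3 h0,
    eulerLog_mul h1 h2]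
  simp only [toda, map_add, map_sub]
  ring

/-! ### The rational solutions -/

theorem lower_eq_upper_sub (u : RatFunc ℂ) : lower u = upper u - 2 * eulerLog u := by
  rw [upper, lower]
  ring

theorem isRationalSolution_uNat_and_toda (m : ℂ) (n : ℕ) :
    IsRationalSolution m n (uNat m n) ∧
    toda m (n + 1) = uNat m n * (upper (uNat m n) + RatFunc.C (2 * n + 2 * m + 1)) ∧
    toda (m - 1) (n + 1) = (upper (uNat m n) + RatFunc.C (-2 * n + 2 * m - 1)) / uNat m n ∧
    toda m n = (lower (uNat m n) + RatFunc.C (-2 * n + 2 * m + 1)) / uNat m n := by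
  induction n with
  | zero =>
    have h1 : upper (1 : RatFunc ℂ) = 4 * x := by
      simp [upper, eulerLog]
      ring
    have h2 : lower (1 : RatFunc ℂ) = 4 * x := by
      rw [lower_eq, h1]
      ring
    rw [uNat_zero, h1, h2, toda_zero, toda_one, toda_one]
    refine ⟨(isRationalSolution_iff_eulerLog _ _ _).mpr ⟨one_ne_zero, ?_⟩, ?_, ?_, ?_⟩
    · simp [eulerLog]
    · simp
    · simp only [CharP.cast_eq_zero, mul_zero, zero_add, div_one]
      congr 2
      ring
    · simp
  | succ n ih =>
    obtain ⟨hs, hA, hB, hA'⟩ := ih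
    set u := uNat m n
    obtain ⟨D, hD⟩ : ∃ D, D = upper u + RatFunc.C (2 * n + 2 * m + 1) := ⟨_, rfl⟩
    obtain ⟨N, hN⟩ : ∃ N, N = upper u + RatFunc.C (-2 * n + 2 * m - 1) := ⟨_, rfl⟩
    rw [← hD] at hA
    rw [← hN] at hB
    have hu : u ≠ 0 := uNat_ne_zero m n
    have hD0 : D ≠ 0 := right_ne_zero_of_mul (hA ▸ (toda_ne_zero_and_intDegree m (n + 1)).1)
    have hN0 : N ≠ 0 := fun h =>
      (toda_ne_zero_and_intDegree (m - 1) (n + 1)).1 (by rw [hB, h, zero_div])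
    have hv : uNat m (n + 1) = N / (u * D) := by
      rw [uNat_succ, hA, hB]
      change u * _ / _ = _
      field_simp
    have hW := ((isRationalSolution_iff_upper m n u).mp hs).2
    rw [← hD, ← hN] at hW
    have hl := lower_backlund hu hD0 hN0 hD hN hW hv
    have hv0 := uNat_ne_zero m (n + 1)
    have hs' : IsRationalSolution m (n + 1) (uNat m (n + 1)) :=
      isRationalSolution_backlund hs hD0 hN0 hD hN hv
    have hT : toda m (n + 2) = uNat m (n + 1) *
        (upper (uNat m (n + 1)) + RatFunc.C (2 * (n + 1) + 2 * m + 1)) := by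
      rw [toda_succ_succ, hA, hA']
      exact toda_backlund hu hD0 hN0 hD hN hW hv
    have e2 : (-2 * (n + 1) + 2 * m + 1 : ℂ) = -2 * n + 2 * m - 1 := by ring
    have hA1 : toda m (n + 1) = N / uNat m (n + 1) := by
      rw [hv, hA]
      field_simp
    push_cast
    refine ⟨hs', hT, ?_, ?_⟩
    · have hV := ((isRationalSolution_iff_lower m (n + 1) _).mp hs').2
      have hW' := ((isRationalSolution_iff_upper m (n + 1) _).mp hs').2
      have hBu : toda (m - 1) (n + 1) = uNat m (n + 1) * D := by
        rw [hv, hB]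
        field_simp
      have hE : 2 * ratDer (eulerLog (uNat m (n + 1))) =
          ratDer (upper (uNat m (n + 1))) - ratDer (lower (uNat m (n + 1))) := by
        rw [lower_eq_upper_sub, map_sub, Derivation.leibniz, ratDer_two]
        simp
      have e1 : (2 * (n + 1) + 2 * m - 1 : ℂ) = 2 * n + 2 * m + 1 := by ring
      rw [hV, hW', hl, e1, e2, ← hD, ← hN] at hE
      refine mul_left_cancel₀ (two_ne_zero (α := RatFunc ℂ)) ?_
      rw [toda_pred, hT, hA1, hBu]
      linear_combination -hE
    · rw [hl, e2, ← hN, hA1]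

theorem IsRationalSolution.inv {m n : ℂ} {u : RatFunc ℂ} (h : IsRationalSolution m n u) :
    IsRationalSolution m (-n) u⁻¹ := by
  rw [isRationalSolution_iff_eulerLog] at h ⊢
  obtain ⟨hu, h⟩ := h
  refine ⟨inv_ne_zero hu, ?_⟩
  rw [eulerLog_inv, map_neg, h]
  simp only [map_add, map_sub, map_neg]
  field_simp
  ring

theorem eulerLog_refl (u : RatFunc ℂ) : eulerLog (-refl u) = refl (eulerLog u) := by
  rw [eulerLog, eulerLog, map_neg, ratDer_refl, map_div₀, map_mul, refl_X]
  ring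

theorem IsRationalSolution.oddReflection {m n : ℂ} {u : RatFunc ℂ}
    (h : IsRationalSolution m n u) : IsRationalSolution m n (oddReflection u) := by
  rw [isRationalSolution_iff_eulerLog] at h ⊢
  obtain ⟨hu, h⟩ := h
  rw [oddReflection_eq]
  refine ⟨neg_ne_zero.mpr ((map_ne_zero refl).mpr hu), ?_⟩
  rw [eulerLog_refl, ratDer_refl, h]
  simp only [map_add, map_sub, map_mul, map_div₀, map_pow, refl_X, map_ofNat, refl_C]
  field_simp
  ring

theorem isRationalSolution_uInt (m : ℂ) (n : ℤ) : IsRationalSolution m n (uInt m n) := by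
  rw [uInt]
  split_ifs with h
  · lift n to ℕ using h
    exact (isRationalSolution_uNat_and_toda m n).1
  · obtain ⟨k, hk⟩ := Int.eq_ofNat_of_zero_le (show 0 ≤ -n by omega)
    obtain rfl : n = -(k : ℤ) := by omega
    have := (isRationalSolution_uNat_and_toda m k).1.inv
    simpa using this

/-! ### Values at infinity -/

theorem inv_sub_C_mem_degLE {c : ℂ} (hc : c ≠ 0) {u : RatFunc ℂ}
    (hu : u - RatFunc.C c ∈ degLE (-1)) : u⁻¹ - RatFunc.C c⁻¹ ∈ degLE (-1) := by
  obtain ⟨hu0, hd⟩ := intDegree_eq_zero_of_sub_C_mem hc hu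
  have hc' : RatFunc.C c ≠ 0 := by simpa using hc
  have h := mul_mem_degLE (mul_mem_degLE hu (inv_mem_degLE (u := u))) (C_mem_degLE (-c⁻¹))
  rw [hd] at h
  convert! h using 1
  rw [map_neg, map_inv₀]
  field_simp
  ring

theorem uNat_sub_one_mem_degLE (m : ℂ) (n : ℕ) : uNat m n - RatFunc.C 1 ∈ degLE (-1) := by
  induction n with
  | zero => simp [uNat_zero]
  | succ n ih =>
    obtain ⟨hu0, hd⟩ := intDegree_eq_zero_of_sub_C_mem one_ne_zero ih
    obtain ⟨h4, hT⟩ := toda_ne_zero_and_intDegree m (n + 1)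
    have h1 : toda (m - 1) (n + 1) - toda m (n + 1) ∈ degLE 0 := by
      simpa using (degLE 0).sub_mem (toda_sub_mem_degLE (m - 1) (n + 1))
        (toda_sub_mem_degLE m (n + 1))
    have h2 := mul_mem_degLE (mul_mem_degLE (mem_degLE_intDegree (uNat m n)) h1)
      (inv_mem_degLE (u := toda m (n + 1)))
    rw [hd, hT] at h2
    convert! (degLE (-1)).add_mem ih h2 using 1
    rw [uNat_succ]
    field_simp
    ring

theorem uInt_sub_one_mem_degLE (m : ℂ) (n : ℤ) : uInt m n - RatFunc.C 1 ∈ degLE (-1) := by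
  rw [uInt]
  split_ifs with h
  · exact uNat_sub_one_mem_degLE m _
  · simpa using inv_sub_C_mem_degLE one_ne_zero (uNat_sub_one_mem_degLE m (-n).toNat)

theorem oddReflection_sub_C_mem_degLE {c : ℂ} {u : RatFunc ℂ}
    (hu : u - RatFunc.C c ∈ degLE (-1)) : oddReflection u - RatFunc.C (-c) ∈ degLE (-1) := by
  have := (degLE (-1)).neg_mem (refl_mem_degLE hu)
  rw [oddReflection_eq]
  convert! this using 1
  rw [map_sub, refl_C, map_neg]
  ring

/-! ### Solutions at infinity -/

theorem IsRationalSolution.cleared {m n : ℂ} {u : RatFunc ℂ} (h : IsRationalSolution m n u) :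
    x * u * ratDer (ratDer u) - x * ratDer u ^ 2 + u * ratDer u =
      4 * RatFunc.C (n + m) * u ^ 3 + 4 * RatFunc.C (n - m) * u + 4 * x * (u ^ 4 - 1) := by
  obtain ⟨hu, h⟩ := h
  have hx : x ≠ 0 := RatFunc.X_ne_zero
  have h1 : (1 : RatFunc ℂ) - RatFunc.C (m - n + 1) = RatFunc.C (n - m) := by
    simp only [map_sub, map_add, map_one]
    ring
  rw [h1, ratDeriv_eq, ratDeriv_eq] at h
  rw [h]
  field_simp
  ring

theorem mul_mem_degLE_of_le {d e f : ℤ} {u v : RatFunc ℂ} (hu : u ∈ degLE d) (hv : v ∈ degLE e)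
    (h : d + e ≤ f) : u * v ∈ degLE f :=
  degLE_mono h (mul_mem_degLE hu hv)

theorem mem_degLE_of_four_mul_X_mul_mem {d : ℤ} {u : RatFunc ℂ} (h : 4 * x * u ∈ degLE (d + 1)) :
    u ∈ degLE d := by
  obtain ⟨h0, h1⟩ := intDegree_four_mul_X
  have h2 := inv_mem_degLE (u := 4 * x)
  rw [h1] at h2
  have := mul_mem_degLE_of_le h2 h (f := d) (by omega)
  rwa [inv_mul_cancel_left₀ h0] at this

theorem mem_degLE_neg_one_of_mul {u v : RatFunc ℂ} (h : u * v ∈ degLE (-1)) :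
    u ∈ degLE (-1) ∨ v ∈ degLE (-1) := by
  by_contra! hc
  simp only [mem_degLE, not_or] at hc
  obtain ⟨⟨hu, hu'⟩, hv, hv'⟩ := hc
  have := intDegree_le_of_mem (mul_ne_zero hu hv) h
  rw [RatFunc.intDegree_mul hu hv] at this
  omega

theorem cleared_left_mem_degLE {d : ℤ} {u : RatFunc ℂ} (hu : u ∈ degLE d) :
    x * u * ratDer (ratDer u) - x * ratDer u ^ 2 + u * ratDer u ∈ degLE (2 * d - 1) := by
  have h1 := ratDer_mem_degLE hu
  have h2 := ratDer_mem_degLE h1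
  refine (degLE _).add_mem ((degLE _).sub_mem ?_ ?_) ?_
  · exact mul_mem_degLE_of_le (mul_mem_degLE X_mem_degLE hu) h2 (by omega)
  · exact mul_mem_degLE_of_le X_mem_degLE (pow_mem_degLE h1 2) (by push_cast; omega)
  · exact mul_mem_degLE_of_le hu h1 (by omega)

theorem four_mul_C_mem_degLE (c : ℂ) : 4 * RatFunc.C c ∈ degLE 0 :=
  mul_mem_degLE_of_le (ofNat_mem_degLE 4) (C_mem_degLE c) (by norm_num)

theorem IsRationalSolution.intDegree_eq_zero {m n : ℂ} {u : RatFunc ℂ}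
    (h : IsRationalSolution m n u) : u.intDegree = 0 := by
  have hu := h.1
  have hd := mem_degLE_intDegree u
  have h0 := cleared_left_mem_degLE hd
  have h1 := mul_mem_degLE (four_mul_C_mem_degLE (n + m)) (pow_mem_degLE hd 3)
  have h2 := mul_mem_degLE (four_mul_C_mem_degLE (n - m)) hd
  have h3 := pow_mem_degLE hd 4
  have he := h.cleared
  push_cast at h1 h3
  rcases lt_trichotomy u.intDegree 0 with hlt | heq | hgt
  · have h4 : 4 * x * 1 ∈ degLE (-1 + 1) := by
      have : 4 * x * 1 = 4 * RatFunc.C (n + m) * u ^ 3 + 4 * RatFunc.C (n - m) * u +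
          4 * x * u ^ 4 - (x * u * ratDer (ratDer u) - x * ratDer u ^ 2 + u * ratDer u) := by
        rw [he]
        ring
      rw [this]
      refine (degLE _).sub_mem ((degLE _).add_mem ((degLE _).add_mem ?_ ?_) ?_) ?_
      · exact degLE_mono (by omega) h1
      · exact degLE_mono (by omega) h2
      · exact mul_mem_degLE_of_le (Or.inr intDegree_four_mul_X.2.le : 4 * x ∈ degLE 1) h3 (by omega)
      · exact degLE_mono (by omega) h0
    have := intDegree_le_of_mem one_ne_zero (mem_degLE_of_four_mul_X_mul_mem h4)
    simp at this
  · exact heq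
  · have h4 : 4 * x * u ^ 4 ∈ degLE (4 * u.intDegree - 1 + 1) := by
      have : 4 * x * u ^ 4 = x * u * ratDer (ratDer u) - x * ratDer u ^ 2 + u * ratDer u -
          4 * RatFunc.C (n + m) * u ^ 3 - 4 * RatFunc.C (n - m) * u + 4 * x := by
        rw [he]
        ring
      rw [this]
      refine (degLE _).add_mem ((degLE _).sub_mem ((degLE _).sub_mem ?_ ?_) ?_) ?_
      · exact degLE_mono (by omega) h0
      · exact degLE_mono (by omega) h1
      · exact degLE_mono (by omega) h2
      · exact degLE_mono (by omega) (Or.inr intDegree_four_mul_X.2.le : 4 * x ∈ degLE 1)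
    have h5 := intDegree_le_of_mem (pow_ne_zero 4 hu) (mem_degLE_of_four_mul_X_mul_mem h4)
    have h6 : (u ^ 4).intDegree = 4 * u.intDegree := by
      rw [show u ^ 4 = u * u * (u * u) by ring, RatFunc.intDegree_mul (mul_ne_zero hu hu)
        (mul_ne_zero hu hu), RatFunc.intDegree_mul hu hu]
      ring
    omega

theorem IsRationalSolution.value_at_infinity {m n : ℂ} {u : RatFunc ℂ}
    (h : IsRationalSolution m n u) :
    u - RatFunc.C 1 ∈ degLE (-1) ∨ u - RatFunc.C (-1) ∈ degLE (-1) ∨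
      ∃ c : ℂ, c ^ 2 = -1 ∧ u - RatFunc.C c ∈ degLE (-1) := by
  have hd := mem_degLE_intDegree u
  rw [h.intDegree_eq_zero] at hd
  have h0 := cleared_left_mem_degLE hd
  have h1 := mul_mem_degLE (four_mul_C_mem_degLE (n + m)) (pow_mem_degLE hd 3)
  have h2 := mul_mem_degLE (four_mul_C_mem_degLE (n - m)) hd
  have he := h.cleared
  have h4 : 4 * x * (u ^ 4 - 1) ∈ degLE (-1 + 1) := by
    have : 4 * x * (u ^ 4 - 1) = x * u * ratDer (ratDer u) - x * ratDer u ^ 2 + u * ratDer u -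
        4 * RatFunc.C (n + m) * u ^ 3 - 4 * RatFunc.C (n - m) * u := by
      rw [he]
      ring
    rw [this]
    refine (degLE _).sub_mem ((degLE _).sub_mem ?_ ?_) ?_
    · exact degLE_mono (by norm_num) h0
    · exact degLE_mono (by norm_num) h1
    · exact degLE_mono (by norm_num) h2
  have h5 := mem_degLE_of_four_mul_X_mul_mem h4
  have hI : RatFunc.C Complex.I ^ 2 = -1 := by
    rw [← map_pow, Complex.I_sq, map_neg, map_one]
  have h6 : u ^ 4 - 1 = (u - RatFunc.C 1) * (u - RatFunc.C (-1)) *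
      ((u - RatFunc.C Complex.I) * (u - RatFunc.C (-Complex.I))) := by
    simp only [map_neg, map_one]
    linear_combination (u ^ 2 - 1) * hI
  rw [h6] at h5
  rcases mem_degLE_neg_one_of_mul h5 with h5 | h5
  · rcases mem_degLE_neg_one_of_mul h5 with h5 | h5
    · exact Or.inl h5
    · exact Or.inr (Or.inl h5)
  · refine Or.inr (Or.inr ?_)
    rcases mem_degLE_neg_one_of_mul h5 with h5 | h5
    · exact ⟨_, Complex.I_sq, h5⟩
    · exact ⟨_, by simp, h5⟩

theorem IsRationalSolution.eq_of_value_at_infinity_eq {m n c : ℂ} (hc : c ≠ 0) {u v : RatFunc ℂ}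
    (hu : IsRationalSolution m n u) (hv : IsRationalSolution m n v)
    (huc : u - RatFunc.C c ∈ degLE (-1)) (hvc : v - RatFunc.C c ∈ degLE (-1)) : u = v := by
  by_contra hne
  have hδ : u - v ≠ 0 := sub_ne_zero.mpr hne
  have hd := mem_degLE_intDegree (u - v)
  set d := (u - v).intDegree
  have hu0 := mem_degLE_intDegree u
  rw [hu.intDegree_eq_zero] at hu0
  have hv0 := mem_degLE_intDegree v
  rw [hv.intDegree_eq_zero] at hv0
  have hd1 := ratDer_mem_degLE hd
  have hd2 := ratDer_mem_degLE hd1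
  have hu1 := ratDer_mem_degLE hu0
  have hu2 := ratDer_mem_degLE hu1
  have hv1 := ratDer_mem_degLE hv0
  have hC := C_mem_degLE c
  have hS : (u + v) * (u ^ 2 + v ^ 2) - RatFunc.C (4 * c ^ 3) ∈ degLE (-1) := by
    have h1 : u ^ 2 + v ^ 2 ∈ degLE 0 := by
      have hu' := pow_mem_degLE hu0 2
      have hv' := pow_mem_degLE hv0 2
      rw [mul_zero] at hu' hv'
      exact (degLE 0).add_mem hu' hv'
    have h2 := mul_mem_degLE_of_le ((degLE _).add_mem huc hvc) h1 (f := -1) (by norm_num)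
    have h3 := mul_mem_degLE_of_le (mul_mem_degLE (C_mem_degLE (2 * c)) huc)
      ((degLE _).add_mem hu0 hC) (f := -1) (by norm_num)
    have h4 := mul_mem_degLE_of_le (mul_mem_degLE (C_mem_degLE (2 * c)) hvc)
      ((degLE _).add_mem hv0 hC) (f := -1) (by norm_num)
    convert! (degLE _).add_mem h2 ((degLE _).add_mem h3 h4) using 1
    simp only [map_mul, map_pow, map_ofNat]
    ring
  obtain ⟨hS0, hSd⟩ := intDegree_eq_zero_of_sub_C_mem (by simpa using hc) hS
  have hQ : u ^ 2 + u * v + v ^ 2 ∈ degLE 0 := by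
    have hu' := pow_mem_degLE hu0 2
    have hv' := pow_mem_degLE hv0 2
    rw [mul_zero] at hu' hv'
    exact (degLE 0).add_mem ((degLE 0).add_mem hu' (mul_mem_degLE_of_le hu0 hv0 le_rfl)) hv'
  have hmem : 4 * x * ((u - v) * ((u + v) * (u ^ 2 + v ^ 2))) ∈ degLE (d - 1 + 1) := by
    have he : 4 * x * ((u - v) * ((u + v) * (u ^ 2 + v ^ 2))) =
        x * (u - v) * ratDer (ratDer u) + x * v * ratDer (ratDer (u - v))
        - x * ratDer (u - v) * (ratDer u + ratDer v) + (u - v) * ratDer u + v * ratDer (u - v)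
        - 4 * RatFunc.C (n + m) * (u - v) * (u ^ 2 + u * v + v ^ 2)
        - 4 * RatFunc.C (n - m) * (u - v) := by
      simp only [map_sub (f := ratDer)]
      linear_combination hv.cleared - hu.cleared
    rw [he]
    refine (degLE _).sub_mem ((degLE _).sub_mem ((degLE _).add_mem ((degLE _).add_mem
      ((degLE _).sub_mem ((degLE _).add_mem ?_ ?_) ?_) ?_) ?_) ?_) ?_
    · exact mul_mem_degLE_of_le (mul_mem_degLE X_mem_degLE hd) hu2 (by omega)
    · exact mul_mem_degLE_of_le (mul_mem_degLE X_mem_degLE hv0) hd2 (by omega)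
    · exact mul_mem_degLE_of_le (mul_mem_degLE X_mem_degLE hd1) ((degLE _).add_mem hu1 hv1)
        (by omega)
    · exact mul_mem_degLE_of_le hd hu1 (by omega)
    · exact mul_mem_degLE_of_le hv0 hd1 (by omega)
    · exact mul_mem_degLE_of_le (mul_mem_degLE (four_mul_C_mem_degLE _) hd) hQ (by omega)
    · exact mul_mem_degLE_of_le (four_mul_C_mem_degLE _) hd (by omega)
  have hle := intDegree_le_of_mem (mul_ne_zero hδ hS0) (mem_degLE_of_four_mul_X_mul_mem hmem)
  rw [RatFunc.intDegree_mul hδ hS0, hSd] at hle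
  omega

/-! ### Residues -/

theorem IsRationalSolution.num_denom {m n : ℂ} {p q : ℂ[X]} (hq : q ≠ 0)
    (h : IsRationalSolution m n (ι p / ι q)) :
    X * ((p * derivative (derivative p) - derivative p ^ 2) * q ^ 2
        - p ^ 2 * (q * derivative (derivative q) - derivative q ^ 2))
      + p * q * (derivative p * q - p * derivative q) =
    4 * C (n + m) * p ^ 3 * q + 4 * C (n - m) * p * q ^ 3 + 4 * X * (p ^ 4 - q ^ 4) := by
  have he := h.cleared
  have hq' : ι q ≠ 0 := RatFunc.algebraMap_ne_zero hq
  have hι : ∀ r : ℂ[X], ratDer (ι r) = ι (derivative r) := ratDeriv_algebraMap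
  simp only [ratDer_div, Derivation.leibniz, map_sub, Derivation.leibniz_pow, smul_eq_mul, hι] at he
  apply RatFunc.algebraMap_injective ℂ
  simp only [map_add, map_sub, map_mul, map_pow, RatFunc.algebraMap_X, RatFunc.algebraMap_C,
    map_ofNat] at he ⊢
  field_simp at he
  refine mul_left_cancel₀ hq' ?_
  linear_combination he

theorem algebraMap_div_mem_degLE_neg_one {R q : ℂ[X]} (hq : q ≠ 0) :
    ι R / ι q ∈ degLE (-1) ↔ R.degree < q.degree := by
  rcases eq_or_ne R 0 with rfl | hR
  · simp [hq, bot_lt_iff_ne_bot]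
  have h1 := RatFunc.algebraMap_ne_zero hR
  have h2 := RatFunc.algebraMap_ne_zero hq
  rw [mem_degLE, or_iff_right (div_ne_zero h1 h2), RatFunc.intDegree_div h1 h2,
    RatFunc.intDegree_polynomial, RatFunc.intDegree_polynomial,
    degree_eq_natDegree hR, degree_eq_natDegree hq, Nat.cast_lt]
  omega

theorem leading_coeff_at_infinity {m n c a : ℂ} (hc : c ^ 2 = -1) {u : RatFunc ℂ}
    (h : IsRationalSolution m n u) (huc : u - RatFunc.C c ∈ degLE (-1))
    (ha : x * (u - RatFunc.C c) - RatFunc.C a ∈ degLE (-1)) : m = -2 * a := by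
  have hc0 : c ≠ 0 := by
    rintro rfl
    norm_num at hc
  have hu0 := mem_degLE_intDegree u
  rw [h.intDegree_eq_zero] at hu0
  have hC := C_mem_degLE c
  have h1 : u * u ∈ degLE 0 := mul_mem_degLE_of_le hu0 hu0 le_rfl
  have h2 : u * RatFunc.C c ∈ degLE 0 := mul_mem_degLE_of_le hu0 hC le_rfl
  have h3 : RatFunc.C c * RatFunc.C c ∈ degLE 0 := mul_mem_degLE_of_le hC hC le_rfl
  have hS3 : (u - RatFunc.C c) * (u * u + u * RatFunc.C c + RatFunc.C c * RatFunc.C c) ∈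
      degLE (-1) :=
    mul_mem_degLE_of_le huc ((degLE _).add_mem ((degLE _).add_mem h1 h2) h3) (by norm_num)
  have hS : (u - RatFunc.C c) * (u * u + (u * RatFunc.C c + u * RatFunc.C c) +
      (RatFunc.C c * RatFunc.C c + RatFunc.C c * RatFunc.C c + RatFunc.C c * RatFunc.C c)) ∈
      degLE (-1) :=
    mul_mem_degLE_of_le huc ((degLE _).add_mem ((degLE _).add_mem h1 ((degLE _).add_mem h2 h2))
      ((degLE _).add_mem ((degLE _).add_mem h3 h3) h3)) (by norm_num)
  have hT : u * u * u + u * u * RatFunc.C c + u * (RatFunc.C c * RatFunc.C c)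
      + RatFunc.C c * (RatFunc.C c * RatFunc.C c) ∈ degLE 0 :=
    (degLE _).add_mem ((degLE _).add_mem ((degLE _).add_mem (mul_mem_degLE_of_le h1 hu0 le_rfl)
      (mul_mem_degLE_of_le h1 hC le_rfl)) (mul_mem_degLE_of_le hu0 h3 le_rfl))
      (mul_mem_degLE_of_le hC h3 le_rfl)
  have hL := cleared_left_mem_degLE hu0
  have e1 := mul_mem_degLE_of_le (four_mul_C_mem_degLE (n + m)) hS3 (f := -1) (by norm_num)
  have e2 := mul_mem_degLE_of_le (four_mul_C_mem_degLE (n - m)) huc (f := -1) (by norm_num)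
  have e3 := mul_mem_degLE_of_le (mul_mem_degLE (ofNat_mem_degLE 4) ha) hT (f := -1) (by norm_num)
  have e4 := mul_mem_degLE_of_le (four_mul_C_mem_degLE a) hS (f := -1) (by norm_num)
  have hz : RatFunc.C (4 * (n + m) * c ^ 3 + 4 * (n - m) * c + 16 * a * c ^ 3) ∈ degLE (-1) := by
    convert! (degLE (-1)).sub_mem (degLE_mono (by norm_num) hL)
      ((degLE _).add_mem ((degLE _).add_mem e1 e2) ((degLE _).add_mem e3 e4)) using 1
    rw [h.cleared]
    have hc4 : RatFunc.C c ^ 4 = 1 := by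
      rw [← map_pow, show c ^ 4 = (c ^ 2) ^ 2 by ring, hc]
      norm_num
    simp only [map_add, map_sub, map_mul, map_pow, map_ofNat]
    linear_combination -4 * x * hc4
  have hz0 := C_mem_degLE_neg hz
  have hz1 : -8 * c * (m + 2 * a) = 0 := by
    linear_combination hz0 - (4 * (n + m) * c + 16 * a * c) * hc
  rcases mul_eq_zero.mp hz1 with h0 | h0
  · simp [hc0] at h0
  · linear_combination h0

theorem derivative_sq_at_pole {m n : ℂ} {p q : ℂ[X]} (hpq : IsCoprime p q) (hq : q ≠ 0)
    (h : IsRationalSolution m n (ι p / ι q)) {z : ℂ} (hz : z ≠ 0) (hqz : q.eval z = 0) :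
    p.eval z ≠ 0 ∧ (derivative q).eval z ^ 2 = 4 * p.eval z ^ 2 := by
  have hp : p.eval z ≠ 0 := by
    intro hp
    obtain ⟨a, b, hab⟩ := hpq
    have := congrArg (eval z) hab
    simp [hp, hqz] at this
  refine ⟨hp, ?_⟩
  have he := congrArg (eval z) (h.num_denom hq)
  simp only [eval_add, eval_sub, eval_mul, eval_pow, eval_X, hqz] at he
  have h4 : eval z (4 : ℂ[X]) = 4 := eval_ofNat 4 z
  rw [h4] at he
  apply mul_left_cancel₀ (mul_ne_zero hz (pow_ne_zero 2 hp))
  linear_combination he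

theorem coeff_eq_sum_div_derivative {R q : ℂ[X]} (hq : q.Monic)
    (hroots : ∀ z, q.eval z = 0 → (derivative q).eval z ≠ 0) (hR : R.degree < q.degree) :
    R.coeff (q.natDegree - 1) =
      ∑ z ∈ q.roots.toFinset, R.eval z / (derivative q).eval z := by
  have hs := IsAlgClosed.splits q
  have hnodup : q.roots.Nodup := by
    rw [Multiset.nodup_iff_count_le_one]
    intro z
    rw [count_roots]
    by_contra! hlt
    obtain ⟨h1, h2⟩ := (one_lt_rootMultiplicity_iff_isRoot hq.ne_zero).mp hlt
    exact hroots z h1 h2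
  have hnodal : q = Lagrange.nodal q.roots.toFinset id := by
    conv_lhs => rw [hs.eq_prod_roots_of_monic hq]
    rw [Lagrange.nodal_eq, Finset.prod, Multiset.toFinset_val, hnodup.dedup]
    rfl
  have hcard : q.roots.toFinset.card = q.natDegree := by
    conv_rhs => rw [hnodal, Lagrange.natDegree_nodal]
  rw [← hcard, Lagrange.coeff_eq_sum (v := id) (Set.injOn_id _)
    (by rwa [hcard, ← degree_eq_natDegree hq.ne_zero])]
  refine Finset.sum_congr rfl fun z hz => ?_
  have := Lagrange.eval_nodal_derivative_eval_node_eq (v := id) hz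
  rw [← hnodal, Lagrange.eval_nodal] at this
  change _ = _ / (derivative q).eval (id z)
  rw [this]
  rfl

theorem exists_int_of_sum {s : Finset ℂ} {f : ℂ → ℂ}
    (h : ∀ z ∈ s, ∃ k : ℤ, -2 * f z = k) : ∃ k : ℤ, -2 * ∑ z ∈ s, f z = k := by
  choose! g hg using h
  refine ⟨∑ z ∈ s, g z, ?_⟩
  rw [Finset.mul_sum, Int.cast_sum]
  exact Finset.sum_congr rfl hg

theorem IsRationalSolution.exists_int_of_denom {m n c : ℂ} (hc : c ^ 2 = -1) {u : RatFunc ℂ}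
    (h : IsRationalSolution m n u) (huc : u - RatFunc.C c ∈ degLE (-1))
    (h0 : u.denom.eval 0 ≠ 0) : ∃ k : ℤ, m = k := by
  have hq := u.denom_ne_zero
  have hq' : ι u.denom ≠ 0 := RatFunc.algebraMap_ne_zero hq
  have hmon := RatFunc.monic_denom u
  have hu : u = ι u.num / ι u.denom := (RatFunc.num_div_denom u).symm
  have hpole : ∀ z, u.denom.eval z = 0 →
      u.num.eval z ≠ 0 ∧ (derivative u.denom).eval z ^ 2 = 4 * u.num.eval z ^ 2 := fun z hz =>
    derivative_sq_at_pole (RatFunc.isCoprime_num_denom u) hq (hu ▸ h)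
      (fun hz0 => h0 (hz0 ▸ hz)) hz
  have hroots : ∀ z, u.denom.eval z = 0 → (derivative u.denom).eval z ≠ 0 := by
    intro z hz hd
    obtain ⟨h1, h2⟩ := hpole z hz
    rw [hd] at h2
    simp [h1] at h2
  obtain ⟨R, hR⟩ : ∃ R, R = u.num - C c * u.denom := ⟨_, rfl⟩
  have huR : u - RatFunc.C c = ι R / ι u.denom := by
    rw [hR, map_sub, map_mul, RatFunc.algebraMap_C, sub_div, mul_div_cancel_right₀ _ hq', ← hu]
  have hdeg : R.degree < u.denom.degree := by
    rwa [huR, algebraMap_div_mem_degLE_neg_one hq] at huc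
  have hcoeff := coeff_eq_sum_div_derivative hmon hroots hdeg
  have ha : x * (u - RatFunc.C c) - RatFunc.C (R.coeff (u.denom.natDegree - 1)) ∈ degLE (-1) := by
    have : x * (u - RatFunc.C c) - RatFunc.C (R.coeff (u.denom.natDegree - 1)) =
        ι (X * R - C (R.coeff (u.denom.natDegree - 1)) * u.denom) / ι u.denom := by
      rw [huR, map_sub, map_mul, map_mul, RatFunc.algebraMap_C, RatFunc.algebraMap_X, sub_div,
        mul_div_cancel_right₀ _ hq', mul_div_assoc]
    rw [this, algebraMap_div_mem_degLE_neg_one hq, degree_eq_natDegree hq, degree_lt_iff_coeff_zero]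
    intro k hk
    have hRk : ∀ j, u.denom.natDegree ≤ j → R.coeff j = 0 := fun j hj =>
      coeff_eq_zero_of_degree_lt (hdeg.trans_le (degree_eq_natDegree hq ▸ by exact_mod_cast hj))
    rw [coeff_sub, coeff_C_mul]
    rcases k with _ | k
    · rw [coeff_X_mul_zero, hRk _ (by omega), zero_mul, sub_zero]
    · rw [coeff_X_mul]
      rcases hk.eq_or_lt with hk | hk
      · rw [← hk, hmon.coeff_natDegree, hk, Nat.add_sub_cancel, mul_one, sub_self]
      · rw [hRk k (by omega), coeff_eq_zero_of_natDegree_lt hk, mul_zero, sub_self]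
  rw [leading_coeff_at_infinity hc h huc ha, hcoeff]
  refine exists_int_of_sum fun z hz => ?_
  have hz' : u.denom.eval z = 0 := by
    rw [Multiset.mem_toFinset, mem_roots hq] at hz
    exact hz
  obtain ⟨h1, h2⟩ := hpole z hz'
  have h3 := hroots z hz'
  have hRz : R.eval z = u.num.eval z := by simp [hR, hz']
  rw [hRz]
  rcases mul_eq_zero.mp (show ((derivative u.denom).eval z - 2 * u.num.eval z) *
      ((derivative u.denom).eval z + 2 * u.num.eval z) = 0 by linear_combination h2) with h4 | h4
  · refine ⟨-1, ?_⟩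
    field_simp
    push_cast
    linear_combination h4
  · refine ⟨1, ?_⟩
    field_simp
    push_cast
    linear_combination -h4

theorem IsRationalSolution.exists_int {m n c : ℂ} (hc : c ^ 2 = -1) {u : RatFunc ℂ}
    (h : IsRationalSolution m n u) (huc : u - RatFunc.C c ∈ degLE (-1)) : ∃ k : ℤ, m = k := by
  by_cases h0 : u.denom.eval 0 = 0
  · have hc0 : c ≠ 0 := by
      rintro rfl
      norm_num at hc
    refine h.inv.exists_int_of_denom (c := c⁻¹) (by rw [inv_pow, hc]; norm_num)
      (inv_sub_C_mem_degLE hc0 huc) fun hi => ?_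
    have hnum : u.num.eval 0 = 0 := by
      obtain ⟨r, hr⟩ := (RatFunc.associated_denom_inv h.1).dvd
      rw [hr, eval_mul, hi, zero_mul]
    obtain ⟨a, b, hab⟩ := RatFunc.isCoprime_num_denom u
    have := congrArg (eval 0) hab
    simp [hnum, h0] at this
  · exact h.exists_int_of_denom hc huc h0

end PainleveIII

end

theorem mainTheorem6 (m : ℂ) (hm : ∀ k : ℤ, m ≠ (k : ℂ)) (n : ℤ) :
    {u : RatFunc ℂ | PainleveIII.IsRationalSolution m (n : ℂ) u} =
        {PainleveIII.uInt m n, PainleveIII.oddReflection (PainleveIII.uInt m n)} ∧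
      PainleveIII.uInt m n ≠ PainleveIII.oddReflection (PainleveIII.uInt m n) := by
  have h := PainleveIII.isRationalSolution_uInt m n
  have h1 := PainleveIII.uInt_sub_one_mem_degLE m n
  have h2 := PainleveIII.oddReflection_sub_C_mem_degLE h1
  constructor
  · ext u
    rw [Set.mem_ofPred_eq, Set.mem_insert_iff, Set.mem_singleton_iff]
    constructor
    · intro hu
      rcases hu.value_at_infinity with hc | hc | ⟨c, hc, huc⟩
      · exact Or.inl (hu.eq_of_value_at_infinity_eq one_ne_zero h hc h1)
      · exact Or.inr (hu.eq_of_value_at_infinity_eq (by norm_num) h.oddReflection hc h2)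
      · obtain ⟨k, hk⟩ := hu.exists_int hc huc
        exact absurd hk (hm k)
    · rintro (rfl | rfl)
      · exact h
      · exact h.oddReflection
  · intro he
    rw [← he] at h2
    have h3 := (PainleveIII.degLE (-1)).sub_mem h2 h1
    rw [sub_sub_sub_cancel_left, ← map_sub] at h3
    have := PainleveIII.C_mem_degLE_neg h3
    norm_num at this
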